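/- Let $n\ge 1$ and $[n]=\{1,\dots,n\}$. In the hyperplane $J=\{x\in\mathbb R^n : x_1+\dots+x_n=1\}$ consider the arrangement $\mathcal H_n$ induced by the hyperplanes $H(A,B)=\{x\in\mathbb{R}^n : \sum_{a\in A}x_a-\sum_{b\in B}x_b=0\}$, where $A,B$ run over the pairs of disjoint subsets of $[n]$, not both empty. Its regions are the connected components of the complement of these hyperplanes in $J$, and the facets of a region are the facets (faces of codimension one) of its closure. Let $M(n)$ be the maximal number of facets of a region of $\mathcal H_n$, and let $M^+(n)$ be the same maximum over the regions contained in the positive orthant only. A comparative probability order on $[n]$ is a linear order $\preceq$ on the subsets of $[n]$ such that $\emptyset\prec A$ for every nonempty $A$, and $A\preceq B\iff A\cup C\preceq B\cup C$ whenever $(A\cup B)\cap C=\emptyset$. It is representable if there is a probability measure $p$ on $[n]$ with $A\preceq B\iff p(A)\le p(B)$ for all $A,B$. A pair $(A,B)$ of disjoint subsets is flippable for $\preceq$ if for every $D\subseteq[n]\setminus(A\cup B)$ (including $D=\emptyset$) the set $A\cup D$ immediately precedes $B\cup D$ in $\preceq$. Let $m(n)$ be the maximal number of flippable pairs of a representable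 comparative probability order on $[n]$. Let $H(x)=-x\log_2x-(1-x)\log_2(1-x)$. There is exactly one $\lambda\in(0,\tfrac12)$ with $\lambda+H(\lambda)=1$, and $1.7087<2^{H(\lambda)}<1.70875$. There are constants $a,b>0$ such that for all sufficiently large $n$ $$a\cdot 1.6180^n< M^+(n)\le M(n)\le m(n)< b\cdot\bigl(2^{H(\lambda)}\bigr)^n .$$ Moreover, for all $n\ge 102$, $$F_{n+1}=\left[\frac{\phi^{n+1}}{\sqrt5}\right]\le m(n)\le 1.7548^n,$$ where $F_1=F_2=1$, $F_{k+2}=F_{k+1}+F_k$ are the Fibonacci numbers, $\phi=(1+\sqrt5)/2$, and $[x]$ is the integer closest to $x$. -/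

import Mathlib

open Filter

noncomputable section

/-! Comparative probability orders on the subsets of an `n`-element set. -/

/-- A comparative probability order on `n` atoms: a linear order `r A B` ("`A ≼ B`") on the
subsets of `Fin n` in which the empty set is strictly below every nonempty set and which satisfies
de Finetti's axiom. -/
structure IsCompProbOrder {n : ℕ} (r : Finset (Fin n) → Finset (Fin n) → Prop) : Prop where
  refl : ∀ A, r A A
  trans : ∀ A B C, r A B → r B C → r A C
  antisymm : ∀ A B, r A B → r B A → A = B
  total : ∀ A B, r A B ∨ r B A
  empty_lt : ∀ A : Finset (Fin n), A.Nonempty → r ∅ A ∧ ¬ r A ∅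
  deFinetti : ∀ A B C : Finset (Fin n), Disjoint (A ∪ B) C → (r A B ↔ r (A ∪ C) (B ∪ C))

/-- A representable comparative probability order: one that is given by a probability measure
`p = (p_1, …, p_n)`. -/
def IsRepresentable {n : ℕ} (r : Finset (Fin n) → Finset (Fin n) → Prop) : Prop :=
  IsCompProbOrder r ∧ ∃ p : Fin n → ℝ, (∀ i, 0 ≤ p i) ∧ ∑ i, p i = 1 ∧
    ∀ A B, r A B ↔ ∑ i ∈ A, p i ≤ ∑ i ∈ B, p i

/-- `A ≺ B`. -/
def StrictlyBelow {n : ℕ} (r : Finset (Fin n) → Finset (Fin n) → Prop)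
    (A B : Finset (Fin n)) : Prop :=
  r A B ∧ ¬ r B A

/-- `A ≺ B` and there is no set strictly between `A` and `B`. -/
def IsAdjacent {n : ℕ} (r : Finset (Fin n) → Finset (Fin n) → Prop)
    (A B : Finset (Fin n)) : Prop :=
  StrictlyBelow r A B ∧ ¬ ∃ C, StrictlyBelow r A C ∧ StrictlyBelow r C B

/-- A critical pair: a pair of disjoint sets that is adjacent. -/
def IsCritical {n : ℕ} (r : Finset (Fin n) → Finset (Fin n) → Prop)
    (A B : Finset (Fin n)) : Prop :=
  Disjoint A B ∧ IsAdjacent r A B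

/-- A flippable pair: a critical pair `(A, B)` such that `(A ∪ D, B ∪ D)` is adjacent for every `D`
disjoint from `A ∪ B`. -/
def IsFlippable {n : ℕ} (r : Finset (Fin n) → Finset (Fin n) → Prop)
    (A B : Finset (Fin n)) : Prop :=
  IsCritical r A B ∧ ∀ D : Finset (Fin n), Disjoint D (A ∪ B) → IsAdjacent r (A ∪ D) (B ∪ D)

/-- `m(n)`: the maximal number of flippable pairs of a representable order on `n` atoms. -/
def maxFlippable (n : ℕ) : ℕ :=
  sSup {k : ℕ | ∃ r : Finset (Fin n) → Finset (Fin n) → Prop, IsRepresentable r ∧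
    {q : Finset (Fin n) × Finset (Fin n) | IsFlippable r q.1 q.2}.ncard = k}

/-! The hyperplane arrangement. -/

/-- The hyperplane `H(A, B)` of all `x` with `∑_{a ∈ A} x_a - ∑_{b ∈ B} x_b = 0`. -/
def diffHyperplane {n : ℕ} (A B : Finset (Fin n)) : Set (Fin n → ℝ) :=
  {x | ∑ a ∈ A, x a - ∑ b ∈ B, x b = 0}

/-- The affine hyperplane `J` given by `x_1 + ⋯ + x_n = 1`. -/
def unitSumHyperplane (n : ℕ) : Set (Fin n → ℝ) :=
  {x | ∑ i, x i = 1}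

/-- The complement, inside `J`, of the union of all the hyperplanes `H(A, B)` with `A`, `B`
disjoint and not both empty. -/
def arrangementComplement (n : ℕ) : Set (Fin n → ℝ) :=
  {x | x ∈ unitSumHyperplane n ∧ ∀ A B : Finset (Fin n), Disjoint A B → (A ∪ B).Nonempty →
    x ∉ diffHyperplane A B}

/-- The (open) regions of the arrangement induced on `J`: the connected components of the
complement of the hyperplanes in `J`. -/
def IsRegion (n : ℕ) (R : Set (Fin n → ℝ)) : Prop :=
  ∃ x ∈ arrangementComplement n, R = connectedComponentIn (arrangementComplement n) x

/-- A facet of the polyhedron `P`: a nonempty exposed face of dimension `dim P - 1`, where the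
dimension is that of the affine span. -/
def IsFacet {n : ℕ} (P F : Set (Fin n → ℝ)) : Prop :=
  F.Nonempty ∧ IsExposed ℝ P F ∧
    Module.finrank ℝ (vectorSpan ℝ F) + 1 = Module.finrank ℝ (vectorSpan ℝ P)

/-- The number of facets of the closure of `R`. -/
def facetCount {n : ℕ} (R : Set (Fin n → ℝ)) : ℕ :=
  {F : Set (Fin n → ℝ) | IsFacet (closure R) F}.ncard

/-- `M(n)`: the maximal number of facets of the (closed) regions. -/
def maxFacets (n : ℕ) : ℕ :=
  sSup {k : ℕ | ∃ R : Set (Fin n → ℝ), IsRegion n R ∧ facetCount R = k}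

/-- The same maximum taken only over the regions in the positive orthant, that is, over those that
correspond to representable comparative probability orders. -/
def maxFacetsPos (n : ℕ) : ℕ :=
  sSup {k : ℕ | ∃ R : Set (Fin n → ℝ), IsRegion n R ∧ (∀ x ∈ R, ∀ i, 0 < x i) ∧ facetCount R = k}

/-- The binary entropy function, with logarithms to base 2. -/
def entropyTwo (x : ℝ) : ℝ :=
  -(x * Real.logb 2 x) - (1 - x) * Real.logb 2 (1 - x)

end

/-! ### The entropy equation -/

/-! Upper bound. In a representable order a flippable pair is determined by its support `A ∪ B`
(`IsFlippable.eq_of_union_eq`). A pair with support of size `s` produces `2 ^ (n - s)` adjacent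
pairs `(A ∪ D, B ∪ D)`; since a set has at most one successor, the sum of these numbers is at most
`2 ^ n` (`sum_two_pow_le_of_isFlippable`). Pairs with support larger than `(1 - lam) * n` are
counted by their supports, at most `2 ^ (H(lam) * n)`; the others each use up at least `2 ^ (lam *
n)`, so there are at most `2 ^ ((1 - lam) * n)` of them. The equation `lam + H(lam) = 1` balances
the two bounds.

Facets against flippable pairs. A region is the set of points of `J` at which all sign forms have
the same signs as at a base point `p`. The normal of a facet is a sign vector that is not a sum of
two sign vectors positive at `p`. After the coordinates are reflected into the positive orthant,
such a vector is a flippable pair: a set strictly between `A ∪ D` and `B ∪ D` would split it.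

Lower bound. For odd `k` the weights `k, 2, 4, …` are generic and integral, so every positive sign
form is at least `1` there, and every sign vector of value exactly `1` is a facet normal
(`exists_signForm_eq_zero_forall_pos`). Such vectors correspond to signed binary representations of
`k`, and a recursion on neighbouring integers yields a `k` with at least `F_{n+1}` of them. -/

lemma entropyTwo_eq_binEntropy_div (x : ℝ) : entropyTwo x = Real.binEntropy x / Real.log 2 := by
  simp only [entropyTwo, Real.binEntropy, Real.logb, Real.log_inv]
  ring

lemma continuous_entropyTwo : Continuous entropyTwo := by
  have : entropyTwo = fun x => Real.binEntropy x / Real.log 2 :=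
    funext entropyTwo_eq_binEntropy_div
  rw [this]
  fun_prop

lemma strictMonoOn_add_entropyTwo :
    StrictMonoOn (fun x : ℝ => x + entropyTwo x) (Set.Icc 0 2⁻¹) := by
  intro x hx y hy hxy
  have h := Real.binEntropy_strictMonoOn hx hy hxy
  simp only [entropyTwo_eq_binEntropy_div]
  have := div_lt_div_of_pos_right h (Real.log_pos one_lt_two)
  linarith

/-- At a rational point the entropy equation clears its denominators and logarithms, so the sign of
the left side is decided by comparing two natural numbers. -/
lemma div_add_entropyTwo_div_sub_one {a b : ℕ} (ha : 0 < a) (hab : a < b) :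
    ((a : ℝ) / b + entropyTwo (a / b) - 1) * (b * Real.log 2) =
      Real.log (b ^ b) - Real.log (2 ^ (b - a) * a ^ a * (b - a : ℕ) ^ (b - a)) := by
  have hb : (0 : ℝ) < b := by exact_mod_cast ha.trans hab
  have ha' : (0 : ℝ) < a := by exact_mod_cast ha
  have hc : (0 : ℝ) < b - a := by
    have : (a : ℝ) < b := by exact_mod_cast hab
    linarith
  have hl : Real.log 2 ≠ 0 := (Real.log_pos one_lt_two).ne'
  have h1 : 1 - (a : ℝ) / b = (b - a) / b := by field_simp
  rw [entropyTwo, h1, Real.logb, Real.logb, Real.log_div ha'.ne' hb.ne',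
    Real.log_div hc.ne' hb.ne', Nat.cast_sub hab.le, Real.log_mul (by positivity) (by positivity),
    Real.log_mul (by positivity) (by positivity), Real.log_pow, Real.log_pow, Real.log_pow,
    Real.log_pow, Nat.cast_sub hab.le]
  field_simp
  ring

lemma div_add_entropyTwo_div_lt_one {a b : ℕ} (ha : 0 < a) (hab : a < b)
    (h : b ^ b < 2 ^ (b - a) * a ^ a * (b - a) ^ (b - a)) :
    (a : ℝ) / b + entropyTwo (a / b) < 1 := by
  have hb : (0 : ℝ) < b := by exact_mod_cast ha.trans hab
  have hl := Real.log_pos one_lt_two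
  have key := div_add_entropyTwo_div_sub_one ha hab
  have h2 : Real.log ((b : ℝ) ^ b) < Real.log (2 ^ (b - a) * a ^ a * (b - a : ℕ) ^ (b - a)) :=
    Real.log_lt_log (by positivity) (by exact_mod_cast h)
  have : 0 < (b : ℝ) * Real.log 2 := by positivity
  by_contra! hcon
  have : 0 ≤ ((a : ℝ) / b + entropyTwo (a / b) - 1) * (b * Real.log 2) :=
    mul_nonneg (by linarith) this.le
  linarith

lemma one_lt_div_add_entropyTwo_div {a b : ℕ} (ha : 0 < a) (hab : a < b)
    (h : 2 ^ (b - a) * a ^ a * (b - a) ^ (b - a) < b ^ b) :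
    1 < (a : ℝ) / b + entropyTwo (a / b) := by
  have hb : (0 : ℝ) < b := by exact_mod_cast ha.trans hab
  have hl := Real.log_pos one_lt_two
  have hc : 0 < b - a := by omega
  have key := div_add_entropyTwo_div_sub_one ha hab
  have h2 : Real.log (2 ^ (b - a) * a ^ a * (b - a : ℕ) ^ (b - a)) < Real.log ((b : ℝ) ^ b) :=
    Real.log_lt_log (by positivity) (by exact_mod_cast h)
  have : 0 < (b : ℝ) * Real.log 2 := by positivity
  by_contra! hcon
  have : ((a : ℝ) / b + entropyTwo (a / b) - 1) * (b * Real.log 2) ≤ 0 :=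
    mul_nonpos_of_nonpos_of_nonneg (by linarith) this.le
  linarith

set_option exponentiation.threshold 1000 in
lemma add_entropyTwo_lt_one : (52 / 229 : ℝ) + entropyTwo (52 / 229) < 1 := by
  have := div_add_entropyTwo_div_lt_one (a := 52) (b := 229) (by norm_num) (by norm_num)
    (by norm_num)
  exact_mod_cast this

set_option exponentiation.threshold 1000 in
lemma one_lt_add_entropyTwo : 1 < (119 / 524 : ℝ) + entropyTwo (119 / 524) := by
  have := one_lt_div_add_entropyTwo_div (a := 119) (b := 524) (by norm_num) (by norm_num)
    (by norm_num)
  exact_mod_cast this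

/-- The two fractions enclose the root so tightly that `2 ^ (1 - lam)`, which equals `2 ^ H(lam)`,
falls between 1.7087 and 1.70875. -/
lemma exists_add_entropyTwo_eq_one :
    ∃ lam : ℝ, 52 / 229 < lam ∧ lam < 119 / 524 ∧ lam + entropyTwo lam = 1 := by
  have hc : ContinuousOn (fun x : ℝ => x + entropyTwo x) (Set.Icc (52 / 229) (119 / 524)) :=
    (continuous_id.add continuous_entropyTwo).continuousOn
  obtain ⟨x, hx, h⟩ := intermediate_value_Ioo (by norm_num) hc
    ⟨add_entropyTwo_lt_one, one_lt_add_entropyTwo⟩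
  exact ⟨x, hx.1, hx.2, h⟩

lemma eq_of_add_entropyTwo_eq_one {x y : ℝ} (hx0 : 0 < x) (hx1 : x < 1 / 2) (hy0 : 0 < y)
    (hy1 : y < 1 / 2) (hx : x + entropyTwo x = 1) (hy : y + entropyTwo y = 1) : x = y :=
  strictMonoOn_add_entropyTwo.injOn ⟨hx0.le, by linarith⟩ ⟨hy0.le, by linarith⟩
    (show x + entropyTwo x = y + entropyTwo y by rw [hx, hy])

lemma two_rpow_one_sub_div_pow {a b : ℕ} (hab : a < b) :
    ((2 : ℝ) ^ (1 - (a : ℝ) / b)) ^ b = 2 ^ (b - a) := by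
  have hb : (0 : ℝ) < b := by exact_mod_cast (Nat.zero_le a).trans_lt hab
  rw [← Real.rpow_natCast, ← Real.rpow_mul (by norm_num), ← Real.rpow_natCast,
    Nat.cast_sub hab.le]
  congr 1
  field_simp

set_option exponentiation.threshold 1000 in
lemma two_rpow_one_sub_lt {lam : ℝ} (h : 52 / 229 < lam) : (2 : ℝ) ^ (1 - lam) < 1.70875 := by
  have h1 : (2 : ℝ) ^ (1 - lam) < 2 ^ (1 - ((52 : ℕ) : ℝ) / (229 : ℕ)) :=
    Real.rpow_lt_rpow_of_exponent_lt one_lt_two (by push_cast; linarith)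
  refine h1.trans (lt_of_pow_lt_pow_left₀ 229 (by norm_num) ?_)
  rw [two_rpow_one_sub_div_pow (by norm_num)]
  norm_num

set_option exponentiation.threshold 1000 in
lemma lt_two_rpow_one_sub {lam : ℝ} (h : lam < 119 / 524) : 1.7087 < (2 : ℝ) ^ (1 - lam) := by
  have h1 : (2 : ℝ) ^ (1 - ((119 : ℕ) : ℝ) / (524 : ℕ)) < (2 : ℝ) ^ (1 - lam) :=
    Real.rpow_lt_rpow_of_exponent_lt one_lt_two (by push_cast; linarith)
  refine lt_trans (lt_of_pow_lt_pow_left₀ 524 (by positivity) ?_) h1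
  rw [two_rpow_one_sub_div_pow (by norm_num)]
  norm_num

/-! ### Fibonacci numbers -/

lemma fib_eq_round (n : ℕ) :
    (Nat.fib (n + 1) : ℤ) = round (Real.goldenRatio ^ (n + 1) / √5) := by
  have h5 : (2 : ℝ) < √5 := by
    rw [Real.lt_sqrt (by norm_num)]
    norm_num
  have h := Real.coe_fib_eq (n + 1)
  -- This is the error term in Binet's formula; it is small enough for rounding because the
  -- conjugate has modulus at most 1 and `√5 > 2`.
  have hpsi : |Real.goldenConj ^ (n + 1) / √5| < 1 / 2 := by
    have h1 : |Real.goldenConj| ≤ 1 :=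
      abs_le.2 ⟨Real.neg_one_lt_goldenConj.le, (Real.goldenConj_neg.trans one_pos).le⟩
    rw [abs_div, abs_pow, abs_of_pos (by linarith : 0 < √5), div_lt_div_iff₀ (by linarith) two_pos]
    have := pow_le_one₀ (n := n + 1) (abs_nonneg _) h1
    linarith
  rw [abs_lt] at hpsi
  symm
  rw [round_eq, Int.floor_eq_iff]
  rw [sub_div] at h
  push_cast
  constructor <;> linarith

/-- The induction works because 1.6180 lies below the golden ratio: its square is less than 2.6180.
-/
lemma pow_lt_mul_fib (n : ℕ) : (1 / 3 : ℝ) * 1.6180 ^ n < Nat.fib (n + 1) := by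
  induction n using Nat.twoStepInduction with
  | zero => norm_num
  | one => norm_num
  | more n h1 h2 =>
    rw [show n + 2 + 1 = (n + 1) + 2 by ring, Nat.fib_add_two]
    push_cast
    have : (0 : ℝ) < 1.6180 ^ n := by positivity
    have e1 : (1.6180 : ℝ) ^ (n + 1) = 1.6180 ^ n * 1.6180 := pow_succ _ _
    have e2 : (1.6180 : ℝ) ^ (n + 2) = 1.6180 ^ n * 1.6180 ^ 2 := pow_add _ _ _
    rw [e2]
    rw [e1] at h2
    norm_num at *
    linarith

lemma two_mul_pow_le {c : ℝ} (hc0 : 0 ≤ c) (hc : c < 1.70875) {n : ℕ} (hn : 102 ≤ n) :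
    2 * c ^ n ≤ (1.7548 : ℝ) ^ n := by
  have h1 : c ^ n ≤ (1.70875 : ℝ) ^ n := pow_le_pow_left₀ hc0 hc.le n
  have h2 : (1.7548 : ℝ) ^ n = (1.7548 / 1.70875) ^ n * 1.70875 ^ n := by
    rw [← mul_pow]
    norm_num
  have h3 : (2 : ℝ) ≤ (1.7548 / 1.70875) ^ n := by
    -- The ratio of the two bases exceeds 1.02, so Bernoulli's inequality absorbs the factor 2.
    have hb := one_add_mul_le_pow (a := (0.02 : ℝ)) (by norm_num) n
    have hle : (1 + 0.02 : ℝ) ^ n ≤ (1.7548 / 1.70875) ^ n :=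
      pow_le_pow_left₀ (by norm_num) (by norm_num) n
    have hn' : (102 : ℝ) ≤ n := by exact_mod_cast hn
    linarith
  rw [h2]
  have : (0 : ℝ) < 1.70875 ^ n := by positivity
  nlinarith

/-! ### The upper bound on the number of flippable pairs -/

section UpperBound

variable {n : ℕ} {r : Finset (Fin n) → Finset (Fin n) → Prop}

lemma IsCompProbOrder.strictlyBelow_of_ne (hr : IsCompProbOrder r) {A B : Finset (Fin n)}
    (h : r A B) (hne : A ≠ B) : StrictlyBelow r A B :=
  ⟨h, fun h' => hne (hr.antisymm A B h h')⟩

lemma IsAdjacent.right_unique (hr : IsCompProbOrder r) {A B C : Finset (Fin n)}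
    (hB : IsAdjacent r A B) (hC : IsAdjacent r A C) : B = C := by
  by_contra hne
  rcases hr.total B C with h | h
  · exact hC.2 ⟨B, hB.1, hr.strictlyBelow_of_ne h hne⟩
  · exact hB.2 ⟨C, hC.1, hr.strictlyBelow_of_ne h (Ne.symm hne)⟩

/-- Two flippable pairs with the same support coincide. -/
lemma IsFlippable.eq_of_union_eq (hr : IsRepresentable r) {A B A' B' : Finset (Fin n)}
    (h : IsFlippable r A B) (h' : IsFlippable r A' B') (hU : A ∪ B = A' ∪ B') :
    A = A' ∧ B = B' := by
  obtain ⟨hc, p, -, -, hp⟩ := hr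
  obtain ⟨⟨hd, ⟨hAB, hcov⟩⟩, -⟩ := h
  obtain ⟨⟨hd', ⟨hAB', hcov'⟩⟩, -⟩ := h'
  have hsum : ∑ i ∈ A, p i + ∑ i ∈ B, p i = ∑ i ∈ A', p i + ∑ i ∈ B', p i := by
    rw [← Finset.sum_union hd, ← Finset.sum_union hd', hU]
  simp only [StrictlyBelow, hp, not_le] at hAB hAB' hcov hcov'
  have hA : A = A' := by
    rcases lt_trichotomy (∑ i ∈ A, p i) (∑ i ∈ A', p i) with hlt | heq | hlt
    -- Equal supports have equal total weight, so `p(A) < p(A') < p(B') < p(B)`, and `A'` separates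
    -- the critical pair `(A, B)`.
    · exact absurd ⟨A', ⟨hlt.le, hlt⟩, by constructor <;> linarith⟩ hcov
    · exact hc.antisymm _ _ ((hp _ _).2 heq.le) ((hp _ _).2 heq.ge)
    · exact absurd ⟨A, ⟨hlt.le, hlt⟩, by constructor <;> linarith⟩ hcov'
  refine ⟨hA, ?_⟩
  rw [← Finset.union_sdiff_cancel_left hd, ← Finset.union_sdiff_cancel_left hd', hU, hA]

lemma union_sdiff_union_of_disjoint {α : Type*} [DecidableEq α] {A B D : Finset α}
    (h : Disjoint A B) (hD : Disjoint D (A ∪ B)) : (A ∪ D) \ (B ∪ D) = A := by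
  rw [Finset.disjoint_union_right] at hD
  rw [Finset.union_sdiff_distrib, Finset.sdiff_eq_empty_iff_subset.2 Finset.subset_union_right,
    Finset.union_empty, Finset.sdiff_eq_self_iff_disjoint]
  exact Finset.disjoint_union_right.2 ⟨h, hD.1.symm⟩

lemma union_inter_union_of_disjoint {α : Type*} [DecidableEq α] {A B D : Finset α}
    (h : Disjoint A B) : (A ∪ D) ∩ (B ∪ D) = D := by
  rw [← Finset.inter_union_distrib_right, Finset.disjoint_iff_inter_eq_empty.1 h,
    Finset.empty_union]

/-- A Kraft type inequality for the sizes of the supports of flippable pairs. -/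
lemma sum_two_pow_le_of_isFlippable (hr : IsCompProbOrder r)
    (T : Finset (Finset (Fin n) × Finset (Fin n))) (hT : ∀ q ∈ T, IsFlippable r q.1 q.2) :
    ∑ q ∈ T, 2 ^ (n - (q.1 ∪ q.2).card) ≤ 2 ^ n := by
  classical
  have h1 : (T.sigma fun q => ((q.1 ∪ q.2)ᶜ).powerset).card ≤
      (Finset.univ : Finset (Finset (Fin n))).card := by
    -- The set `A ∪ D` determines its successor `B ∪ D`; differences and intersection of the two
    -- then recover `A`, `B` and `D`.
    refine Finset.card_le_card_of_injOn (fun s => s.1.1 ∪ s.2) (fun _ _ => Finset.mem_univ _) ?_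
    rintro ⟨⟨A, B⟩, D⟩ hs ⟨⟨A', B'⟩, D'⟩ hs' heq
    simp only [Finset.coe_sigma, Set.mem_sigma_iff, Finset.mem_coe, Finset.mem_powerset] at hs hs'
    simp only at heq
    have hD : Disjoint D (A ∪ B) := Finset.subset_compl_iff_disjoint_right.1 hs.2
    have hD' : Disjoint D' (A' ∪ B') := Finset.subset_compl_iff_disjoint_right.1 hs'.2
    have h := hT _ hs.1
    have h' := hT _ hs'.1
    have hdis : Disjoint A B := h.1.1
    have hdis' : Disjoint A' B' := h'.1.1
    have hadj := h.2 D hD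
    have hadj' := h'.2 D' hD'
    simp only at hadj hadj'
    rw [heq] at hadj
    have heq2 := hadj.right_unique hr hadj'
    obtain rfl : A = A' := by
      rw [← union_sdiff_union_of_disjoint hdis hD, ← union_sdiff_union_of_disjoint hdis' hD',
        heq, heq2]
    obtain rfl : B = B' := by
      rw [← union_sdiff_union_of_disjoint hdis.symm (Finset.union_comm A B ▸ hD),
        ← union_sdiff_union_of_disjoint hdis'.symm (Finset.union_comm A B' ▸ hD'), heq, heq2]
    obtain rfl : D = D' := by
      rw [← union_inter_union_of_disjoint (D := D) hdis, heq, heq2,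
        union_inter_union_of_disjoint hdis]
    rfl
  simpa only [Finset.card_sigma, Finset.card_powerset, Finset.card_compl, Finset.card_univ,
    Fintype.card_finset, Fintype.card_fin] using h1

/-- The number of large subsets is bounded by means of the entropy function. -/
lemma card_filter_le_two_rpow_entropyTwo {lam : ℝ} (h0 : 0 < lam) (h1 : lam < 1 / 2) :
    ((Finset.univ.filter fun S : Finset (Fin n) => (1 - lam) * n < S.card).card : ℝ) ≤
      ((2 : ℝ) ^ entropyTwo lam) ^ n := by
  have h1' : 0 < 1 - lam := by linarith
  have hw : (2 : ℝ) ^ (-entropyTwo lam) = lam ^ lam * (1 - lam) ^ (1 - lam) := by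
    have e1 : lam ^ lam = (2 : ℝ) ^ (Real.logb 2 lam * lam) := by
      rw [Real.rpow_mul (by norm_num), Real.rpow_logb two_pos (by norm_num) h0]
    have e2 : (1 - lam) ^ (1 - lam) = (2 : ℝ) ^ (Real.logb 2 (1 - lam) * (1 - lam)) := by
      rw [Real.rpow_mul (by norm_num), Real.rpow_logb two_pos (by norm_num) h1']
    rw [e1, e2, ← Real.rpow_add two_pos, entropyTwo]
    congr 1
    ring
  -- Include each element independently with probability `1 - lam`. The right side is the
  -- probability of `S`; each element beyond `(1 - lam) * n` replaces a factor `lam` by the larger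
  -- `1 - lam`. As the probabilities sum to 1, few sets can be this likely.
  have hle : ∀ S : Finset (Fin n), (1 - lam) * n < S.card →
      ((2 : ℝ) ^ (-entropyTwo lam)) ^ n ≤ (1 - lam) ^ S.card * lam ^ (n - S.card) := by
    intro S hS
    have hSn : S.card ≤ n := by simpa using S.card_le_univ
    rw [hw, mul_pow, ← Real.rpow_natCast (lam ^ lam), ← Real.rpow_natCast ((1 - lam) ^ (1 - lam)),
      ← Real.rpow_mul h0.le, ← Real.rpow_mul h1'.le, ← Real.rpow_natCast, ← Real.rpow_natCast,
      Nat.cast_sub hSn]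
    set t : ℝ := S.card - (1 - lam) * n with ht
    have ht0 : 0 < t := by linarith
    have e1 : (S.card : ℝ) = (1 - lam) * n + t := by linarith
    have e2 : (n : ℝ) - S.card = lam * n - t := by linarith
    rw [e2, e1, Real.rpow_add h1', Real.rpow_sub h0]
    have h3 : lam ^ t ≤ (1 - lam) ^ t := Real.rpow_le_rpow h0.le (by linarith) ht0.le
    have h4 : 0 < lam ^ t := Real.rpow_pos_of_pos h0 t
    have h5 : 0 < lam ^ (lam * n) * (1 - lam) ^ ((1 - lam) * n) := by positivity
    rw [show (1 - lam) ^ ((1 - lam) * (n : ℝ)) * (1 - lam) ^ t * (lam ^ (lam * n) / lam ^ t) =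
      (lam ^ (lam * n) * (1 - lam) ^ ((1 - lam) * n)) * ((1 - lam) ^ t / lam ^ t) by ring]
    exact le_mul_of_one_le_right h5.le ((one_le_div h4).2 h3)
  have hsum : ∑ S : Finset (Fin n), (1 - lam) ^ S.card * lam ^ (n - S.card) = 1 := by
    rw [Fin.sum_pow_mul_eq_add_pow]
    simp
  have hbound : ((Finset.univ.filter fun S : Finset (Fin n) => (1 - lam) * n < S.card).card : ℝ) *
      ((2 : ℝ) ^ (-entropyTwo lam)) ^ n ≤ 1 := by
    rw [← nsmul_eq_mul]
    refine le_trans ?_ hsum.le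
    refine (Finset.card_nsmul_le_sum _ _ _ fun S hS => hle S (Finset.mem_filter.1 hS).2).trans ?_
    refine Finset.sum_le_sum_of_subset_of_nonneg (Finset.filter_subset _ _) fun S _ _ => ?_
    positivity
  rw [Real.rpow_neg (by norm_num), inv_pow] at hbound
  have : (0 : ℝ) < ((2 : ℝ) ^ entropyTwo lam) ^ n := by positivity
  rwa [← div_eq_mul_inv, div_le_one this] at hbound

/-- Large supports are counted by injectivity of the support, small ones by the Kraft inequality;
both counts give the same exponential. -/
lemma card_le_of_isFlippable (hr : IsRepresentable r) {lam : ℝ} (h0 : 0 < lam) (h1 : lam < 1 / 2)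
    (hlam : lam + entropyTwo lam = 1)
    (T : Finset (Finset (Fin n) × Finset (Fin n))) (hT : ∀ q ∈ T, IsFlippable r q.1 q.2) :
    (T.card : ℝ) ≤ 2 * ((2 : ℝ) ^ entropyTwo lam) ^ n := by
  classical
  set P : Finset (Fin n) × Finset (Fin n) → Prop := fun q => (1 - lam) * n < (q.1 ∪ q.2).card
  have hbig : ((T.filter P).card : ℝ) ≤ ((2 : ℝ) ^ entropyTwo lam) ^ n := by
    refine le_trans ?_ (card_filter_le_two_rpow_entropyTwo h0 h1)
    have := Finset.card_le_card_of_injOn (s := T.filter P)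
      (t := Finset.univ.filter fun S : Finset (Fin n) => (1 - lam) * n < S.card)
      (fun q => q.1 ∪ q.2)
      (fun q hq => by
        have := (Finset.mem_filter.1 hq).2
        simpa [P] using this)
      (fun q hq q' hq' h => by
        have := (hT q (Finset.mem_filter.1 hq).1).eq_of_union_eq hr
          (hT q' (Finset.mem_filter.1 hq').1) h
        exact Prod.ext this.1 this.2)
    exact_mod_cast this
  have hsmall : ((T.filter fun q => ¬ P q).card : ℝ) ≤ ((2 : ℝ) ^ entropyTwo lam) ^ n := by
    have hk : ∑ q ∈ T.filter (fun q => ¬ P q), (2 : ℝ) ^ (n - (q.1 ∪ q.2).card) ≤ 2 ^ n := by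
      exact_mod_cast sum_two_pow_le_of_isFlippable hr.1 (T.filter fun q => ¬ P q)
        fun q hq => hT q (Finset.mem_filter.1 hq).1
    have hge : ∀ q ∈ T.filter (fun q => ¬ P q),
        (2 : ℝ) ^ (lam * n) ≤ (2 : ℝ) ^ (n - (q.1 ∪ q.2).card) := by
      intro q hq
      have hq2 : ¬ (1 - lam) * n < (q.1 ∪ q.2).card := (Finset.mem_filter.1 hq).2
      have hle : (q.1 ∪ q.2).card ≤ n := by simpa using (q.1 ∪ q.2).card_le_univ
      rw [← Real.rpow_natCast, Nat.cast_sub hle]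
      exact Real.rpow_le_rpow_of_exponent_le one_le_two (by linarith)
    have h2 := (Finset.card_nsmul_le_sum _ _ _ hge).trans hk
    rw [nsmul_eq_mul] at h2
    have h3 : (2 : ℝ) ^ n = ((2 : ℝ) ^ entropyTwo lam) ^ n * 2 ^ (lam * n) := by
      rw [← Real.rpow_natCast (_ ^ _), ← Real.rpow_mul (by norm_num), ← Real.rpow_add two_pos,
        ← add_mul, add_comm, hlam, one_mul, Real.rpow_natCast]
    rw [h3] at h2
    exact le_of_mul_le_mul_right h2 (by positivity)
  have := Finset.card_filter_add_card_filter_not (s := T) P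
  rw [← this]
  push_cast
  linarith

lemma maxFlippable_le {lam : ℝ} (h0 : 0 < lam) (h1 : lam < 1 / 2)
    (hlam : lam + entropyTwo lam = 1) (n : ℕ) :
    (maxFlippable n : ℝ) ≤ 2 * ((2 : ℝ) ^ entropyTwo lam) ^ n := by
  have hfl : maxFlippable n ≤ ⌊2 * ((2 : ℝ) ^ entropyTwo lam) ^ n⌋₊ := by
    refine csSup_le' ?_
    rintro k ⟨r, hr, rfl⟩
    refine Nat.le_floor ?_
    classical
    rw [Set.ncard_eq_toFinset_card']
    exact card_le_of_isFlippable hr h0 h1 hlam _ fun q hq => by simpa using hq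
  exact (Nat.cast_le.2 hfl).trans (Nat.floor_le (by positivity))

lemma ncard_le_maxFlippable (hr : IsRepresentable r) :
    {q : Finset (Fin n) × Finset (Fin n) | IsFlippable r q.1 q.2}.ncard ≤ maxFlippable n := by
  -- Boundedness matters: `sSup` of an unbounded set of naturals is 0.
  refine le_csSup ⟨Nat.card (Finset (Fin n) × Finset (Fin n)), ?_⟩ ⟨r, hr, rfl⟩
  rintro k ⟨r, -, rfl⟩
  exact Set.ncard_le_card _

end UpperBound

/-! ### Sign vectors -/

section SignVectors

variable {n : ℕ}

/-- The linear form on `ℝⁿ` whose coefficients are given by a sign vector. -/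
def signForm (w : Fin n → SignType) : (Fin n → ℝ) →ₗ[ℝ] ℝ :=
  ∑ i, ((w i : ℝ)) • LinearMap.proj i

lemma signForm_apply (w : Fin n → SignType) (x : Fin n → ℝ) :
    signForm w x = ∑ i, (w i : ℝ) * x i := by
  simp [signForm]

lemma signForm_one_apply (x : Fin n → ℝ) : signForm (1 : Fin n → SignType) x = ∑ i, x i := by
  simp [signForm_apply]

lemma continuous_signForm (w : Fin n → SignType) : Continuous (signForm w) :=
  LinearMap.continuous_of_finiteDimensional _

lemma signForm_neg (w : Fin n → SignType) (x : Fin n → ℝ) :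
    signForm (-w) x = -signForm w x := by
  simp [signForm_apply]

lemma signForm_single (w : Fin n → SignType) (i : Fin n) :
    signForm w (Pi.single i 1) = w i := by
  simp [signForm_apply, Pi.single_apply]

/-- The sign vector of the difference of two indicator functions. -/
def diffSign (A B : Finset (Fin n)) (i : Fin n) : SignType :=
  if i ∈ A \ B then 1 else if i ∈ B \ A then -1 else 0

lemma coe_diffSign (A B : Finset (Fin n)) (i : Fin n) :
    (diffSign A B i : ℝ) = (if i ∈ A then 1 else 0) - (if i ∈ B then 1 else 0) := by
  by_cases hA : i ∈ A <;> by_cases hB : i ∈ B <;> simp [diffSign, hA, hB]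

lemma signForm_diffSign (A B : Finset (Fin n)) (x : Fin n → ℝ) :
    signForm (diffSign A B) x = ∑ i ∈ A, x i - ∑ i ∈ B, x i := by
  simp [signForm_apply, coe_diffSign, sub_mul, Finset.sum_sub_distrib]

lemma diffSign_eq_zero_iff {A B : Finset (Fin n)} : diffSign A B = 0 ↔ A = B := by
  constructor
  · intro h
    ext i
    have := congrFun h i
    by_cases hA : i ∈ A <;> by_cases hB : i ∈ B <;> simp_all [diffSign]
  · rintro rfl
    ext i
    simp [diffSign]

/-- The set of indices with positive sign. -/
def posSupp (w : Fin n → SignType) : Finset (Fin n) := Finset.univ.filter fun i => w i = 1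

/-- The set of indices with negative sign. -/
def negSupp (w : Fin n → SignType) : Finset (Fin n) := Finset.univ.filter fun i => w i = -1

lemma mem_posSupp {w : Fin n → SignType} {i : Fin n} : i ∈ posSupp w ↔ w i = 1 := by
  simp [posSupp]

lemma mem_negSupp {w : Fin n → SignType} {i : Fin n} : i ∈ negSupp w ↔ w i = -1 := by
  simp [negSupp]

lemma disjoint_posSupp_negSupp (w : Fin n → SignType) : Disjoint (posSupp w) (negSupp w) := by
  refine Finset.disjoint_left.2 fun i hi hi' => ?_
  rw [mem_posSupp] at hi
  rw [mem_negSupp, hi] at hi'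
  exact absurd hi' (by decide)

lemma diffSign_posSupp_negSupp (w : Fin n → SignType) :
    diffSign (posSupp w) (negSupp w) = w := by
  ext i
  rcases (w i).trichotomy with h | h | h <;> simp [diffSign, mem_posSupp, mem_negSupp, h]

/-! ### Regions as sign cells -/

/-- A point on none of the hyperplanes through the origin whose normals are sign vectors. -/
def IsGeneric (p : Fin n → ℝ) : Prop := ∀ w : Fin n → SignType, w ≠ 0 → signForm w p ≠ 0

lemma mem_arrangementComplement_iff {x : Fin n → ℝ} :
    x ∈ arrangementComplement n ↔ ∑ i, x i = 1 ∧ IsGeneric x := by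
  refine and_congr Iff.rfl ⟨fun h w hw => ?_, fun h A B hAB hne hmem => ?_⟩
  · have hd := disjoint_posSupp_negSupp w
    have := h _ _ hd (by
      rw [Finset.nonempty_iff_ne_empty, Ne, Finset.union_eq_empty]
      rintro ⟨h1, h2⟩
      rw [← diffSign_posSupp_negSupp w, h1, h2] at hw
      exact hw (diffSign_eq_zero_iff.2 rfl))
    rwa [diffHyperplane, Set.mem_ofPred_eq, ← signForm_diffSign, diffSign_posSupp_negSupp] at this
  · refine h (diffSign A B) ?_ ?_
    · rw [Ne, diffSign_eq_zero_iff]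
      rintro rfl
      rw [disjoint_self] at hAB
      simp only [Finset.bot_eq_empty] at hAB
      simp [hAB] at hne
    · rw [signForm_diffSign]
      exact hmem

/-- The points of the hyperplane `J` on the same side as `p` of each of the hyperplanes. -/
def signCell (p : Fin n → ℝ) : Set (Fin n → ℝ) :=
  {y | ∑ i, y i = 1 ∧ ∀ w, 0 < signForm w p → 0 < signForm w y}

/-- The points of the hyperplane `J` weakly on the same side as `p` of each of the hyperplanes. -/
def closedSignCell (p : Fin n → ℝ) : Set (Fin n → ℝ) :=
  {y | ∑ i, y i = 1 ∧ ∀ w, 0 < signForm w p → 0 ≤ signForm w y}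

lemma convex_signCell (p : Fin n → ℝ) : Convex ℝ (signCell p) := by
  intro x hx y hy a b ha hb hab
  refine ⟨?_, fun w hw => ?_⟩
  · rw [← signForm_one_apply, map_add, map_smul, map_smul, signForm_one_apply, signForm_one_apply,
      hx.1, hy.1]
    simpa using hab
  · rw [map_add, map_smul, map_smul]
    exact convex_Ioi (0 : ℝ) (hx.2 w hw) (hy.2 w hw) ha hb hab

lemma signCell_subset_arrangementComplement {p : Fin n → ℝ} (hp : IsGeneric p) :
    signCell p ⊆ arrangementComplement n := by
  refine fun y hy => mem_arrangementComplement_iff.2 ⟨hy.1, fun w hw => ?_⟩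
  rcases (hp w hw).lt_or_gt with h | h
  · have := hy.2 (-w) (by rw [signForm_neg]; linarith)
    rw [signForm_neg] at this
    linarith
  · exact (hy.2 w h).ne'

/-- The cell is convex, hence connected; conversely a form changing sign on the component would
vanish there by the intermediate value theorem. -/
lemma connectedComponentIn_arrangementComplement {p : Fin n → ℝ}
    (hp : p ∈ arrangementComplement n) :
    connectedComponentIn (arrangementComplement n) p = signCell p := by
  obtain ⟨hsum, hgen⟩ := mem_arrangementComplement_iff.1 hp
  refine Set.Subset.antisymm (fun y hy => ?_) ?_
  · have hsub := connectedComponentIn_subset (arrangementComplement n) p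
    refine ⟨(mem_arrangementComplement_iff.1 (hsub hy)).1, fun w hw => ?_⟩
    by_contra! hle
    have hpre : IsPreconnected (connectedComponentIn (arrangementComplement n) p) :=
      isPreconnected_connectedComponentIn
    obtain ⟨z, hz, hz0⟩ := hpre.intermediate_value hy (mem_connectedComponentIn hp)
      (continuous_signForm w).continuousOn ⟨hle, hw.le⟩
    refine (mem_arrangementComplement_iff.1 (hsub hz)).2 w ?_ hz0
    rintro rfl
    simp [signForm_apply] at hw
  · exact (convex_signCell p).isPreconnected.subset_connectedComponentIn ⟨hsum, fun w hw => hw⟩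
      (signCell_subset_arrangementComplement hgen)

lemma closure_signCell {p : Fin n → ℝ} (hp : ∑ i, p i = 1) :
    closure (signCell p) = closedSignCell p := by
  refine Set.Subset.antisymm (closure_minimal (fun y hy => ⟨hy.1, fun w hw => (hy.2 w hw).le⟩) ?_)
    fun y hy => ?_
  · have : closedSignCell p = (signForm 1) ⁻¹' {1} ∩
        ⋂ w, ⋂ _ : 0 < signForm w p, (signForm w) ⁻¹' Set.Ici 0 := by
      ext y
      simp [closedSignCell, signForm_one_apply]
    rw [this]
    exact (isClosed_singleton.preimage (continuous_signForm 1)).inter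
      (isClosed_iInter fun w => isClosed_iInter fun _ =>
        isClosed_Ici.preimage (continuous_signForm w))
  -- Points of the segment from `y` towards `p`, other than `y`, lie strictly inside the cell.
  · have htends : Tendsto (fun t : ℝ => y + t • (p - y)) (nhdsWithin 0 (Set.Ioi 0)) (nhds y) := by
      have : Continuous fun t : ℝ => y + t • (p - y) := by fun_prop
      simpa using (this.tendsto 0).mono_left nhdsWithin_le_nhds
    refine mem_closure_of_tendsto htends ?_
    filter_upwards [Ioo_mem_nhdsGT (zero_lt_one' ℝ)] with t ht
    refine ⟨?_, fun w hw => ?_⟩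
    · rw [← signForm_one_apply, map_add, map_smul, map_sub, signForm_one_apply,
        signForm_one_apply, hy.1, hp]
      simp
    · rw [map_add, map_smul, map_sub, smul_eq_mul]
      have h1 := hy.2 w hw
      nlinarith [ht.1, ht.2, mul_pos ht.1 hw, mul_nonneg (sub_nonneg.2 ht.2.le) h1]

/-! ### Facets of sign cells -/

/-- A positive value at `x` of finitely many sign forms persists under small translations. -/
lemma exists_pos_forall_signForm_add_smul_pos (s : Set (Fin n → SignType)) {x : Fin n → ℝ}
    (hx : ∀ w ∈ s, 0 < signForm w x) (d : Fin n → ℝ) :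
    ∃ t : ℝ, 0 < t ∧ ∀ w ∈ s, 0 < signForm w (x + t • d) := by
  have h : ∀ᶠ t : ℝ in nhdsWithin 0 (Set.Ioi 0), ∀ w : Fin n → SignType, w ∈ s →
      0 < signForm w (x + t • d) := by
    rw [eventually_all]
    intro w
    by_cases hw : w ∈ s
    · have hc : Continuous fun t : ℝ => signForm w (x + t • d) :=
        (continuous_signForm w).comp (by fun_prop)
      have : ∀ᶠ t : ℝ in nhds 0, 0 < signForm w (x + t • d) :=
        hc.continuousAt.eventually (lt_mem_nhds (by simpa using hx w hw))
      filter_upwards [this.filter_mono nhdsWithin_le_nhds] with t ht _ using ht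
    · exact Eventually.of_forall fun t h => absurd h hw
  obtain ⟨t, ht, ht0⟩ := (h.and self_mem_nhdsWithin).exists
  exact ⟨t, ht0, ht⟩

lemma le_vectorSpan_of_forall_exists {V : Type*} [AddCommGroup V] [Module ℝ V] {S : Set V} {x : V}
    (hx : x ∈ S) (K : Submodule ℝ V) (h : ∀ d ∈ K, ∃ t : ℝ, 0 < t ∧ x + t • d ∈ S) :
    K ≤ vectorSpan ℝ S := by
  intro d hd
  obtain ⟨t, ht, hmem⟩ := h d hd
  have := vsub_mem_vectorSpan ℝ hmem hx
  rw [vsub_eq_sub, add_sub_cancel_left] at this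
  exact (Submodule.smul_mem_iff _ ht.ne').1 this

lemma vectorSpan_le_ker {V : Type*} [AddCommGroup V] [Module ℝ V] {S : Set V}
    (f : V →ₗ[ℝ] ℝ) (c : ℝ) (h : ∀ x ∈ S, f x = c) : vectorSpan ℝ S ≤ LinearMap.ker f := by
  refine Submodule.span_le.2 ?_
  rintro _ ⟨x, hx, y, hy, rfl⟩
  simp [h x hx, h y hy]

lemma finrank_inf_ker_add_one {V : Type*} [AddCommGroup V] [Module ℝ V] [FiniteDimensional ℝ V]
    (K : Submodule ℝ V) (f : V →ₗ[ℝ] ℝ) (h : ∃ d ∈ K, f d ≠ 0) :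
    Module.finrank ℝ ↥(K ⊓ LinearMap.ker f) + 1 = Module.finrank ℝ K := by
  obtain ⟨d, hd, hfd⟩ := h
  have h1 : f.domRestrict K ≠ 0 := fun h0 => hfd (by
    have := LinearMap.congr_fun h0 ⟨d, hd⟩
    simpa using this)
  have h2 : (LinearMap.ker (f.domRestrict K)).map K.subtype = K ⊓ LinearMap.ker f := by
    ext x
    simp [and_comm]
  rw [← h2, Submodule.finrank_map_subtype_eq]
  exact Module.Dual.finrank_ker_add_one_of_ne_zero h1

lemma mem_signCell_self {p : Fin n → ℝ} (hp : ∑ i, p i = 1) : p ∈ signCell p :=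
  ⟨hp, fun _ hw => hw⟩

lemma signCell_subset_closedSignCell (p : Fin n → ℝ) : signCell p ⊆ closedSignCell p :=
  fun _ hy => ⟨hy.1, fun w hw => (hy.2 w hw).le⟩

lemma vectorSpan_closedSignCell {p : Fin n → ℝ} (hp : ∑ i, p i = 1) :
    vectorSpan ℝ (closedSignCell p) = LinearMap.ker (signForm (1 : Fin n → SignType)) := by
  refine le_antisymm (vectorSpan_le_ker _ 1 fun x hx => by rw [signForm_one_apply, hx.1]) ?_
  refine le_vectorSpan_of_forall_exists
    (signCell_subset_closedSignCell p (mem_signCell_self hp)) _ fun d hd => ?_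
  obtain ⟨t, ht, h⟩ := exists_pos_forall_signForm_add_smul_pos {w | 0 < signForm w p}
    (fun w hw => hw) d
  refine ⟨t, ht, ?_, fun w hw => (h w hw).le⟩
  rw [← signForm_one_apply, map_add, map_smul, LinearMap.mem_ker.1 hd, signForm_one_apply, hp]
  simp

/-- The face of the closed sign cell of `p` cut out by the sign vector `v`. -/
def signFace (p : Fin n → ℝ) (v : Fin n → SignType) : Set (Fin n → ℝ) :=
  {y ∈ closedSignCell p | signForm v y = 0}

lemma exists_mem_ker_signForm_ne_zero {p x : Fin n → ℝ} {v : Fin n → SignType}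
    (hp : ∑ i, p i = 1) (hx : ∑ i, x i = 1) (hv : 0 < signForm v p) (hvx : signForm v x = 0) :
    ∃ d ∈ LinearMap.ker (signForm (1 : Fin n → SignType)), signForm v d ≠ 0 := by
  refine ⟨p - x, ?_, ?_⟩
  · rw [LinearMap.mem_ker, map_sub, signForm_one_apply, signForm_one_apply, hp, hx, sub_self]
  · rw [map_sub, hvx, sub_zero]
    exact hv.ne'

/-- The point `x` is in the relative interior of the face, so small moves within `v = 0` and `J`
stay in it and the codimension is exactly one. The functional `-v` exposes the face. -/
lemma isFacet_signFace {p x : Fin n → ℝ} {v : Fin n → SignType} (hp : ∑ i, p i = 1)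
    (hv : 0 < signForm v p) (hx : ∑ i, x i = 1) (hvx : signForm v x = 0)
    (h : ∀ w, w ≠ v → 0 < signForm w p → 0 < signForm w x) :
    x ∈ signFace p v ∧ IsFacet (closedSignCell p) (signFace p v) := by
  have hxF : x ∈ signFace p v := by
    refine ⟨⟨hx, fun w hw => ?_⟩, hvx⟩
    by_cases hwv : w = v
    · rw [hwv, hvx]
    · exact (h w hwv hw).le
  refine ⟨hxF, ⟨x, hxF⟩, fun _ => ?_, ?_⟩
  · refine ⟨LinearMap.toContinuousLinearMap (-signForm v), ?_⟩
    ext y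
    simp only [signFace, Set.mem_ofPred_eq, LinearMap.coe_toContinuousLinearMap',
      LinearMap.neg_apply, neg_le_neg_iff]
    refine and_congr_right fun hy => ⟨fun h0 z hz => ?_, fun hle => ?_⟩
    · rw [h0]
      exact hz.2 v hv
    · exact le_antisymm ((hle x hxF.1).trans hvx.le) (hy.2 v hv)
  · have hspan : vectorSpan ℝ (signFace p v) =
        LinearMap.ker (signForm (1 : Fin n → SignType)) ⊓ LinearMap.ker (signForm v) := by
      refine le_antisymm (le_inf (vectorSpan_le_ker _ 1 fun y hy => ?_)
        (vectorSpan_le_ker _ 0 fun y hy => hy.2)) ?_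
      · rw [signForm_one_apply, hy.1.1]
      · refine le_vectorSpan_of_forall_exists hxF _ fun d hd => ?_
        obtain ⟨t, ht, h'⟩ := exists_pos_forall_signForm_add_smul_pos
          {w | w ≠ v ∧ 0 < signForm w p} (fun w hw => h w hw.1 hw.2) d
        have h0 : signForm v (x + t • d) = 0 := by
          rw [map_add, map_smul, hvx, LinearMap.mem_ker.1 hd.2]
          simp
        refine ⟨t, ht, ⟨?_, fun w hw => ?_⟩, h0⟩
        · rw [← signForm_one_apply, map_add, map_smul, LinearMap.mem_ker.1 hd.1,
            signForm_one_apply, hx]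
          simp
        · by_cases hwv : w = v
          · rw [hwv, h0]
          · exact (h' w ⟨hwv, hw⟩).le
    rw [hspan, vectorSpan_closedSignCell hp]
    exact finrank_inf_ker_add_one _ _ (exists_mem_ker_signForm_ne_zero hp hx hv hvx)

/-- A facet of a closed sign cell lies in one of the hyperplanes bounding the cell. -/
lemma exists_signForm_eq_zero_of_isFacet {p : Fin n → ℝ} (hp : ∑ i, p i = 1)
    {F : Set (Fin n → ℝ)} (hF : IsFacet (closedSignCell p) F) :
    ∃ v, 0 < signForm v p ∧ ∀ y ∈ F, signForm v y = 0 := by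
  obtain ⟨hne, hexp, hrank⟩ := hF
  by_contra! hcon
  have hsub := hexp.subset
  have hconv : Convex ℝ (closedSignCell p) := by
    rw [← closure_signCell hp]
    exact (convex_signCell p).closure
  have hFconv : Convex ℝ F := hexp.convex hconv
  -- If no form vanishes on all of `F`, averaging one witness per form gives a point of `F` interior
  -- to the cell relative to `J`.
  obtain ⟨x, hxF, hx⟩ : ∃ x ∈ F, ∀ w, 0 < signForm w p → 0 < signForm w x := by
    choose! y hyF hy using hcon
    set s : Finset (Fin n → SignType) := Finset.univ.filter fun w => 0 < signForm w p with hs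
    obtain ⟨f0, hf0⟩ := hne
    rcases s.eq_empty_or_nonempty with h0 | hsne
    · refine ⟨f0, hf0, fun w hw => ?_⟩
      have : w ∈ s := by simp [hs, hw]
      simp [h0] at this
    · have hc : (0 : ℝ) < (s.card : ℝ)⁻¹ := by
        have := hsne.card_pos
        positivity
      refine ⟨∑ w ∈ s, (s.card : ℝ)⁻¹ • y w, hFconv.sum_mem (fun _ _ => hc.le) ?_ ?_, ?_⟩
      · rw [Finset.sum_const, nsmul_eq_mul, mul_inv_cancel₀ (inv_pos.1 hc).ne']
      · intro w hw
        exact hyF w (by simpa [hs] using hw)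
      · intro w hw
        rw [map_sum]
        refine Finset.sum_pos' (fun u hu => ?_) ⟨w, by simp [hs, hw], ?_⟩
        · rw [map_smul, smul_eq_mul]
          exact mul_nonneg hc.le ((hsub (hyF u (by simpa [hs] using hu))).2 w hw)
        · rw [map_smul, smul_eq_mul]
          exact mul_pos hc (lt_of_le_of_ne ((hsub (hyF w hw)).2 w hw) (hy w hw).symm)
  obtain ⟨l, hl⟩ := hexp ⟨x, hxF⟩
  have hmax : ∀ z ∈ closedSignCell p, l z ≤ l x := by
    rw [hl] at hxF
    exact hxF.2
  have hx1 := (hsub hxF).1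
  -- The exposing functional is maximal at a relatively interior point, hence constant along `J`.
  -- Then `F` is the whole cell, which has the wrong dimension.
  have hmove : ∀ d ∈ LinearMap.ker (signForm (1 : Fin n → SignType)), l d ≤ 0 := by
    intro d hd
    obtain ⟨t, ht, h⟩ := exists_pos_forall_signForm_add_smul_pos {w | 0 < signForm w p} hx d
    have := hmax (x + t • d) ⟨by
      rw [← signForm_one_apply, map_add, map_smul, LinearMap.mem_ker.1 hd, signForm_one_apply, hx1]
      simp, fun w hw => (h w hw).le⟩
    rw [map_add, map_smul, smul_eq_mul] at this
    by_contra! hpos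
    have := mul_pos ht hpos
    linarith
  have hall : F = closedSignCell p := by
    refine hsub.antisymm fun y hy => ?_
    rw [hl]
    refine ⟨hy, fun z hz => (hmax z hz).trans ?_⟩
    have := hmove (x - y) (by
      rw [LinearMap.mem_ker, map_sub, signForm_one_apply, signForm_one_apply, hx1, hy.1, sub_self])
    rw [map_sub] at this
    linarith
  rw [hall] at hrank
  omega

/-- By dimension `F` spans all directions of `J` inside `v = 0`. The exposing functional is constant
on `F`, hence on the entire face cut out by `v`. -/
lemma eq_signFace_of_isFacet {p : Fin n → ℝ} (hp : ∑ i, p i = 1)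
    {F : Set (Fin n → ℝ)} (hF : IsFacet (closedSignCell p) F) {v : Fin n → SignType}
    (hv : 0 < signForm v p) (hvF : ∀ y ∈ F, signForm v y = 0) :
    vectorSpan ℝ F = LinearMap.ker (signForm (1 : Fin n → SignType)) ⊓ LinearMap.ker (signForm v) ∧
      F = signFace p v := by
  obtain ⟨⟨x, hxF⟩, hexp, hrank⟩ := hF
  have hsub := hexp.subset
  have hx1 := (hsub hxF).1
  have hspan : vectorSpan ℝ F =
      LinearMap.ker (signForm (1 : Fin n → SignType)) ⊓ LinearMap.ker (signForm v) := by
    refine Submodule.eq_of_le_of_finrank_eq (le_inf (vectorSpan_le_ker _ 1 fun y hy => ?_)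
      (vectorSpan_le_ker _ 0 hvF)) ?_
    · rw [signForm_one_apply, (hsub hy).1]
    · have := finrank_inf_ker_add_one _ _
        (exists_mem_ker_signForm_ne_zero hp hx1 hv (hvF x hxF))
      rw [vectorSpan_closedSignCell hp] at hrank
      omega
  refine ⟨hspan, Set.Subset.antisymm (fun y hy => ⟨hsub hy, hvF y hy⟩) fun y hy => ?_⟩
  obtain ⟨l, hl⟩ := hexp ⟨x, hxF⟩
  have hlx : ∀ z ∈ F, l z = l x := by
    intro z hz
    rw [hl] at hz hxF
    exact le_antisymm (hxF.2 z hz.1) (hz.2 x hxF.1)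
  have hker := vectorSpan_le_ker (l : (Fin n → ℝ) →ₗ[ℝ] ℝ) (l x) hlx
  rw [hspan] at hker
  have hyx : y - x ∈ LinearMap.ker (l : (Fin n → ℝ) →ₗ[ℝ] ℝ) := hker ⟨by
    rw [SetLike.mem_coe, LinearMap.mem_ker, map_sub, signForm_one_apply, signForm_one_apply, hx1,
      hy.1.1, sub_self], by
    rw [SetLike.mem_coe, LinearMap.mem_ker, map_sub, hy.2, hvF x hxF, sub_self]⟩
  have hly : l y = l x := by
    have : l (y - x) = 0 := hyx
    rw [map_sub] at this
    linarith
  rw [hl] at hxF ⊢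
  exact ⟨hy.1, fun z hz => hly ▸ hxF.2 z hz⟩

/-- A sign vector that is positive at `p` and is not the sum of two such vectors. -/
def IsIndecomposable (p : Fin n → ℝ) (v : Fin n → SignType) : Prop :=
  0 < signForm v p ∧ ∀ w₁ w₂ : Fin n → SignType, (∀ i, (w₁ i : ℝ) + w₂ i = v i) →
    0 < signForm w₁ p → 0 < signForm w₂ p → False

/-- Parity: a sum of two nonzero signs is even, so it is not `±1`. -/
lemma signType_eq_zero_of_coe_add_coe_eq {a b c : SignType} (h : (a : ℝ) + b = c) : a = 0 ∨ b = 0 ∨ c = 0 := by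
  rcases a.trichotomy with rfl | rfl | rfl <;> rcases b.trichotomy with rfl | rfl | rfl <;>
    rcases c.trichotomy with rfl | rfl | rfl <;> first | (simp; done) | norm_num at h

/-- If `v = w₁ + w₂`, both summands are nonnegative on the cell and so vanish on `F`. As `F` spans
its hyperplane, `ker v ≤ ker wⱼ`, and each `wⱼ` is nonzero wherever `v` is, against parity. -/
lemma exists_isIndecomposable_of_isFacet {p : Fin n → ℝ} (hp : ∑ i, p i = 1)
    {F : Set (Fin n → ℝ)} (hF : IsFacet (closedSignCell p) F) :
    ∃ v, IsIndecomposable p v ∧ F = signFace p v := by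
  obtain ⟨v, hv, hvF⟩ := exists_signForm_eq_zero_of_isFacet hp hF
  obtain ⟨hspan, hFv⟩ := eq_signFace_of_isFacet hp hF hv hvF
  refine ⟨v, ⟨hv, fun w₁ w₂ hadd h1 h2 => ?_⟩, hFv⟩
  obtain ⟨x, hxF⟩ := hF.1
  have hsub := hF.2.1.subset
  have hsum : ∀ y, signForm w₁ y + signForm w₂ y = signForm v y := by
    intro y
    simp only [signForm_apply, ← Finset.sum_add_distrib, ← add_mul, hadd]
  have hker : ∀ w, (∀ y ∈ F, signForm w y = 0) →
      ∀ d, signForm v d = 0 → signForm w d = 0 := by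
    intro w hwF d hd
    have hle := vectorSpan_le_ker (signForm w) 0 hwF
    rw [hspan] at hle
    have hmem : d - (signForm 1 d) • x ∈ LinearMap.ker (signForm w) := hle ⟨by
      rw [SetLike.mem_coe, LinearMap.mem_ker, map_sub, map_smul, signForm_one_apply x,
        (hsub hxF).1, smul_eq_mul, mul_one, sub_self], by
      rw [SetLike.mem_coe, LinearMap.mem_ker, map_sub, map_smul, hd, hvF x hxF, smul_zero,
        sub_zero]⟩
    rwa [LinearMap.mem_ker, map_sub, map_smul, hwF x hxF, smul_zero, sub_zero] at hmem
  have hnz : ∀ w, 0 < signForm w p → (∀ y ∈ F, signForm w y = 0) → ∀ i, v i ≠ 0 → w i ≠ 0 := by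
    intro w hw hwF i hvi hwi
    -- This test vector lies in `ker v`; if `w i = 0`, the form `w` takes the value `v i * signForm
    -- w p ≠ 0` on it.
    have := hker w hwF ((v i : ℝ) • p - signForm v p • Pi.single i 1) (by
      rw [map_sub, map_smul, map_smul, signForm_single, smul_eq_mul, smul_eq_mul]
      ring)
    rw [map_sub, map_smul, map_smul, signForm_single, hwi, SignType.coe_zero, smul_zero, sub_zero,
      smul_eq_mul, mul_eq_zero] at this
    rcases this with h | h
    · rcases (v i).trichotomy with h' | h' | h' <;> simp_all
    · exact hw.ne' h
  have hF1 : ∀ y ∈ F, signForm w₁ y = 0 ∧ signForm w₂ y = 0 := by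
    intro y hy
    have a1 := (hsub hy).2 w₁ h1
    have a2 := (hsub hy).2 w₂ h2
    have a3 := hsum y
    rw [hvF y hy] at a3
    constructor <;> linarith
  obtain ⟨i, hi⟩ : ∃ i, v i ≠ 0 := by
    by_contra! h0
    simp [signForm_apply, h0] at hv
  rcases signType_eq_zero_of_coe_add_coe_eq (hadd i) with h | h | h
  · exact hnz w₁ h1 (fun y hy => (hF1 y hy).1) i hi h
  · exact hnz w₂ h2 (fun y hy => (hF1 y hy).2) i hi h
  · exact hi h

end SignVectors

/-! ### Facets give flippable pairs -/

section FacetsToFlippable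

variable {n : ℕ}

/-- The order on the subsets given by comparison of their weights. -/
def weightOrder (q : Fin n → ℝ) (A B : Finset (Fin n)) : Prop := ∑ i ∈ A, q i ≤ ∑ i ∈ B, q i

lemma isRepresentable_weightOrder {q : Fin n → ℝ} (h0 : ∀ i, 0 ≤ q i) (h1 : ∑ i, q i = 1)
    (hq : IsGeneric q) : IsRepresentable (weightOrder q) := by
  have hanti : ∀ A B, weightOrder q A B → weightOrder q B A → A = B := by
    intro A B hAB hBA
    by_contra hne
    refine hq (diffSign A B) (by rwa [Ne, diffSign_eq_zero_iff]) ?_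
    rw [signForm_diffSign, sub_eq_zero]
    exact le_antisymm hAB hBA
  refine ⟨⟨fun A => le_refl _, fun A B C => le_trans, hanti, fun A B => le_total _ _, ?_, ?_⟩,
    q, h0, h1, fun A B => Iff.rfl⟩
  · intro A hA
    have hle : weightOrder q ∅ A := by
      simpa [weightOrder] using Finset.sum_nonneg fun i _ => h0 i
    exact ⟨hle, fun h => hA.ne_empty (hanti _ _ h hle)⟩
  · intro A B C hd
    rw [Finset.disjoint_union_left] at hd
    rw [weightOrder, weightOrder, Finset.sum_union hd.1, Finset.sum_union hd.2,
      add_le_add_iff_right]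

lemma strictlyBelow_weightOrder {q : Fin n → ℝ} {A B : Finset (Fin n)} :
    StrictlyBelow (weightOrder q) A B ↔ ∑ i ∈ A, q i < ∑ i ∈ B, q i := by
  rw [StrictlyBelow, weightOrder, weightOrder, not_le]
  exact and_iff_right_of_imp le_of_lt

/-- A set `C` strictly between the two sides writes `v` as the sum of the differences on either side
of `C`, both positive at `q`. -/
lemma IsIndecomposable.isFlippable {q : Fin n → ℝ} {v : Fin n → SignType}
    (hv : IsIndecomposable q v) : IsFlippable (weightOrder q) (negSupp v) (posSupp v) := by
  have hdis := disjoint_posSupp_negSupp v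
  have hval : signForm v q = ∑ i ∈ posSupp v, q i - ∑ i ∈ negSupp v, q i := by
    rw [← signForm_diffSign, diffSign_posSupp_negSupp]
  have hadj : ∀ D : Finset (Fin n), Disjoint D (negSupp v ∪ posSupp v) →
      IsAdjacent (weightOrder q) (negSupp v ∪ D) (posSupp v ∪ D) := by
    intro D hD
    rw [Finset.disjoint_union_right] at hD
    simp only [IsAdjacent, strictlyBelow_weightOrder]
    refine ⟨?_, ?_⟩
    · rw [Finset.sum_union hD.1.symm, Finset.sum_union hD.2.symm]
      linarith [hv.1]
    · rintro ⟨C, h1, h2⟩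
      refine hv.2 (diffSign C (negSupp v ∪ D)) (diffSign (posSupp v ∪ D) C) (fun i => ?_) ?_ ?_
      · rw [coe_diffSign, coe_diffSign]
        have hvi : (v i : ℝ) = (if i ∈ posSupp v then 1 else 0) -
            (if i ∈ negSupp v then 1 else 0) := by
          rw [← coe_diffSign, diffSign_posSupp_negSupp]
        have e1 : i ∈ D → i ∉ negSupp v := fun h => Finset.disjoint_left.1 hD.1 h
        have e2 : i ∈ D → i ∉ posSupp v := fun h => Finset.disjoint_left.1 hD.2 h
        rw [hvi]
        by_cases hiD : i ∈ D
        · simp [hiD, e1 hiD, e2 hiD]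
        · simp [hiD]
      · rw [signForm_diffSign]
        linarith
      · rw [signForm_diffSign]
        linarith
  refine ⟨⟨hdis.symm, ?_⟩, hadj⟩
  simpa using hadj ∅ (Finset.disjoint_empty_left _)

/-- The coordinatewise product of a sign vector with the signs of the coordinates of `p`. -/
noncomputable def twist (p : Fin n → ℝ) (v : Fin n → SignType) (i : Fin n) : SignType :=
  v i * SignType.sign (p i)

lemma twist_twist {p : Fin n → ℝ} (hp : ∀ i, p i ≠ 0) (v : Fin n → SignType) :
    twist p (twist p v) = v := by
  ext i
  rcases (hp i).lt_or_gt with h | h <;> simp [twist, h]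

lemma coe_mul_sign_mul (a : SignType) (x : ℝ) :
    ((a * SignType.sign x : SignType) : ℝ) * x = a * |x| := by
  rcases lt_trichotomy x 0 with h | rfl | h
  · simp [sign_neg h, abs_of_neg h]
  · simp
  · simp [sign_pos h, abs_of_pos h]

lemma signForm_smul_abs (c : ℝ) (p : Fin n → ℝ) (v : Fin n → SignType) :
    signForm v (c • |p|) = c * signForm (twist p v) p := by
  rw [map_smul, smul_eq_mul, signForm_apply, signForm_apply]
  simp only [twist, coe_mul_sign_mul, Pi.abs_apply]

lemma IsGeneric.ne_zero {p : Fin n → ℝ} (hp : IsGeneric p) (i : Fin n) : p i ≠ 0 := by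
  intro h
  refine hp (diffSign {i} ∅) ?_ ?_
  · rw [Ne, diffSign_eq_zero_iff]
    exact Finset.singleton_ne_empty i
  · rw [signForm_diffSign]
    simpa using h

lemma IsGeneric.smul_abs {p : Fin n → ℝ} (hp : IsGeneric p) {c : ℝ} (hc : c ≠ 0) :
    IsGeneric (c • |p|) := by
  intro w hw
  rw [signForm_smul_abs]
  refine mul_ne_zero hc (hp _ fun h => hw ?_)
  rw [← twist_twist hp.ne_zero w, h]
  ext i
  simp [twist]

lemma IsIndecomposable.twist {p : Fin n → ℝ} (hp : IsGeneric p) {c : ℝ} (hc : 0 < c)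
    {v : Fin n → SignType} (hv : IsIndecomposable p v) :
    IsIndecomposable (c • |p|) (twist p v) := by
  refine ⟨?_, fun w₁ w₂ h h1 h2 =>
    hv.2 (_root_.twist p w₁) (_root_.twist p w₂) (fun i => ?_) ?_ ?_⟩
  · rw [signForm_smul_abs, twist_twist hp.ne_zero]
    exact mul_pos hc hv.1
  · have := h i
    rcases (hp.ne_zero i).lt_or_gt with h' | h' <;>
      simp only [_root_.twist, sign_neg, sign_pos, h', mul_one, mul_neg, SignType.coe_neg] at this ⊢ <;>
      linarith
  · rw [signForm_smul_abs] at h1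
    exact pos_of_mul_pos_right h1 hc.le
  · rw [signForm_smul_abs] at h2
    exact pos_of_mul_pos_right h2 hc.le

/-- Taking absolute values of the coordinates and normalising turns `p` into a probability measure;
twisting the normals accordingly preserves indecomposability. -/
lemma facetCount_signCell_le {p : Fin n → ℝ} (hsum : ∑ i, p i = 1) (hp : IsGeneric p) :
    facetCount (signCell p) ≤ maxFlippable n := by
  have hs : 0 < ∑ i, |p i| :=
    zero_lt_one.trans_le (hsum ▸ Finset.sum_le_sum fun i _ => le_abs_self (p i))
  set c : ℝ := (∑ i, |p i|)⁻¹ with hc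
  have hc0 : 0 < c := inv_pos.2 hs
  have hrep : IsRepresentable (weightOrder (c • |p|)) := by
    refine isRepresentable_weightOrder (fun i => ?_) ?_ (hp.smul_abs hc0.ne')
    · exact mul_nonneg hc0.le (abs_nonneg _)
    · simp only [Pi.smul_apply, Pi.abs_apply, smul_eq_mul, ← Finset.mul_sum]
      exact inv_mul_cancel₀ hs.ne'
  refine le_trans ?_ (ncard_le_maxFlippable hrep)
  rw [facetCount, closure_signCell hsum]
  have h1 : {F | IsFacet (closedSignCell p) F} ⊆ signFace p '' {v | IsIndecomposable p v} := by
    intro F hF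
    obtain ⟨v, hv, rfl⟩ := exists_isIndecomposable_of_isFacet hsum hF
    exact ⟨v, hv, rfl⟩
  refine (Set.ncard_le_ncard h1 (Set.toFinite _)).trans ((Set.ncard_image_le).trans ?_)
  refine Set.ncard_le_ncard_of_injOn (fun v => (negSupp (twist p v), posSupp (twist p v)))
    (fun v hv => (IsIndecomposable.twist hp hc0 hv).isFlippable) (fun v _ w _ h => ?_)
    (Set.toFinite _)
  rw [Prod.mk.injEq] at h
  rw [← twist_twist hp.ne_zero v, ← twist_twist hp.ne_zero w,
    ← diffSign_posSupp_negSupp (twist p v), ← diffSign_posSupp_negSupp (twist p w), h.1, h.2]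

lemma facetCount_le_maxFlippable {R : Set (Fin n → ℝ)} (hR : IsRegion n R) :
    facetCount R ≤ maxFlippable n := by
  obtain ⟨p, hp, rfl⟩ := hR
  rw [connectedComponentIn_arrangementComplement hp]
  obtain ⟨h1, h2⟩ := mem_arrangementComplement_iff.1 hp
  exact facetCount_signCell_le h1 h2

lemma maxFacets_le_maxFlippable (n : ℕ) : maxFacets n ≤ maxFlippable n := by
  refine csSup_le' ?_
  rintro k ⟨R, hR, rfl⟩
  exact facetCount_le_maxFlippable hR

lemma maxFacetsPos_le_maxFacets (n : ℕ) : maxFacetsPos n ≤ maxFacets n := by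
  refine csSup_le_csSup' ⟨maxFlippable n, ?_⟩ ?_
  · rintro k ⟨R, hR, rfl⟩
    exact facetCount_le_maxFlippable hR
  · rintro k ⟨R, hR, -, rfl⟩
    exact ⟨R, hR, rfl⟩

lemma facetCount_le_maxFacetsPos {R : Set (Fin n → ℝ)} (hR : IsRegion n R)
    (hpos : ∀ x ∈ R, ∀ i, 0 < x i) : facetCount R ≤ maxFacetsPos n := by
  refine le_csSup ⟨maxFlippable n, ?_⟩ ⟨R, hR, hpos, rfl⟩
  rintro k ⟨R, hR, -, rfl⟩
  exact facetCount_le_maxFlippable hR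

end FacetsToFlippable

/-! ### Cells with many facets -/

section ManyFacets

variable {n : ℕ}

lemma coe_mul_coe_le (a b : SignType) : (a : ℝ) * b ≤ b * b := by
  rcases a.trichotomy with rfl | rfl | rfl <;> rcases b.trichotomy with rfl | rfl | rfl <;> norm_num

/-- In the equality case of `coe_mul_coe_le`, the difference of two signs is again a sign. -/
lemma coe_ite_eq_zero (a b : SignType) (h : (b : ℝ) * b ≤ a * b) :
    ((if b = 0 then a else 0 : SignType) : ℝ) = a - b := by
  rcases a.trichotomy with rfl | rfl | rfl <;> rcases b.trichotomy with rfl | rfl | rfl <;>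
    first | (norm_num at h; done) | norm_num

/-- If all sign forms take positive values at least `1`, then the sign vectors of value `1`
are the normals of facets. -/
lemma exists_signForm_eq_zero_forall_pos {z : Fin n → ℝ} (hz : IsGeneric z)
    (hone : ∀ w, 0 < signForm w z → 1 ≤ signForm w z) {v : Fin n → SignType}
    (hv : signForm v z = 1) :
    ∃ x, signForm v x = 0 ∧ ∀ w, w ≠ v → 0 < signForm w z → 0 < signForm w x := by
  set N : ℝ := ∑ i, (v i : ℝ) * v i with hN
  have hN0 : 0 < N := by
    obtain ⟨i, hi⟩ : ∃ i, v i ≠ 0 := by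
      by_contra! h0
      simp [signForm_apply, h0] at hv
    refine Finset.sum_pos' (fun i _ => mul_self_nonneg _) ⟨i, Finset.mem_univ i, ?_⟩
    rcases (v i).trichotomy with h | h | h
    · simp [h]
    · exact absurd h hi
    · simp [h]
  have hval : ∀ w, signForm w (z - N⁻¹ • fun i => (v i : ℝ)) =
      signForm w z - (∑ i, (w i : ℝ) * v i) / N := by
    intro w
    rw [map_sub, map_smul, signForm_apply w fun i => (v i : ℝ), smul_eq_mul, inv_mul_eq_div]
  -- The point is the orthogonal projection of `z` to the hyperplane of `v`. A form `w` loses `⟨w,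
  -- v⟩ / N ≤ 1`, while its value at `z` was at least 1.
  refine ⟨z - N⁻¹ • fun i => (v i : ℝ), ?_, fun w hwv hw => ?_⟩
  · rw [hval, hv, ← hN, div_self hN0.ne', sub_self]
  · rw [hval, sub_pos]
    have hle : ∑ i, (w i : ℝ) * v i ≤ N := Finset.sum_le_sum fun i _ => coe_mul_coe_le _ _
    rcases (hone w hw).lt_or_eq with h | h
    · exact ((div_le_one hN0).2 hle).trans_lt h
    · rw [← h, div_lt_one hN0]
      refine lt_of_le_of_ne hle fun heq => hwv ?_
      -- If `⟨w, v⟩ = N`, then `w` agrees with `v` on the support of `v`, so `w - v` is a sign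
      -- vector. It vanishes at `z`, hence is zero by genericity.
      have hall := (Finset.sum_eq_sum_iff_of_le fun i _ => coe_mul_coe_le (w i) (v i)).1 heq
      have hu : ∀ i, ((if v i = 0 then w i else 0 : SignType) : ℝ) = w i - v i := fun i =>
        coe_ite_eq_zero _ _ (hall i (Finset.mem_univ i)).ge
      have hu0 : (fun i => if v i = 0 then w i else 0) = (0 : Fin n → SignType) := by
        by_contra hne
        refine hz _ hne ?_
        rw [signForm_apply]
        simp only [hu, sub_mul, Finset.sum_sub_distrib]
        rw [← signForm_apply, ← signForm_apply, ← h, hv, sub_self]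
      ext i
      have h0 : (w i : ℝ) - v i = 0 := by
        rw [← hu i, congrFun hu0 i]
        simp
      rcases (w i).trichotomy with h1 | h1 | h1 <;> rcases (v i).trichotomy with h2 | h2 | h2 <;>
        simp only [h1, h2] at h0 ⊢ <;> norm_num at h0

lemma ncard_le_maxFacetsPos (hn : 2 ≤ n) {z : Fin n → ℝ} (hz : IsGeneric z) (hpos : ∀ i, 0 < z i)
    (hone : ∀ w, 0 < signForm w z → 1 ≤ signForm w z) :
    {v : Fin n → SignType | signForm v z = 1}.ncard ≤ maxFacetsPos n := by
  have hz1 : ∀ i, 1 ≤ z i := fun i => by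
    have h := hone (diffSign {i} ∅)
    rw [signForm_diffSign] at h
    simpa using h (by simpa using hpos i)
  have hsum : 1 < ∑ i, z i := by
    have h2 : ((2 : ℕ) : ℝ) ≤ n := Nat.cast_le.2 hn
    have h3 := Finset.card_nsmul_le_sum Finset.univ z 1 fun i _ => hz1 i
    simp only [Finset.card_univ, Fintype.card_fin, nsmul_eq_mul, mul_one] at h3
    push_cast at h2
    linarith
  set c : ℝ := (∑ i, z i)⁻¹ with hc
  have hc0 : 0 < c := inv_pos.2 (by linarith)
  have hform : ∀ w, signForm w (c • z) = c * signForm w z := fun w => by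
    rw [map_smul, smul_eq_mul]
  have hform0 : ∀ w, 0 < signForm w (c • z) ↔ 0 < signForm w z := fun w => by
    rw [hform, mul_pos_iff_of_pos_left hc0]
  have hp1 : ∑ i, (c • z) i = 1 := by
    simp only [Pi.smul_apply, smul_eq_mul, ← Finset.mul_sum]
    exact inv_mul_cancel₀ (by linarith)
  have hpg : IsGeneric (c • z) := fun w hw => by
    rw [hform]
    exact mul_ne_zero hc0.ne' (hz w hw)
  have hmem : c • z ∈ arrangementComplement n := mem_arrangementComplement_iff.2 ⟨hp1, hpg⟩
  have hfacet : ∀ v : Fin n → SignType, signForm v z = 1 → ∃ x ∈ signFace (c • z) v,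
      IsFacet (closedSignCell (c • z)) (signFace (c • z) v) ∧
      ∀ w, w ≠ v → 0 < signForm w z → 0 < signForm w x := by
    intro v hv
    obtain ⟨x, hvx, hx⟩ := exists_signForm_eq_zero_forall_pos hz hone hv
    -- The all-ones form exceeds 1 at `z`, which is where `2 ≤ n` enters. So it is not `v`, stays
    -- positive at `x`, and `x` can be scaled into `J`.
    have hxs : 0 < ∑ i, x i := by
      rw [← signForm_one_apply]
      refine hx 1 ?_ ?_
      · rintro rfl
        rw [signForm_one_apply] at hv
        linarith
      · rw [signForm_one_apply]
        linarith
    have hx' : ∀ w, w ≠ v → 0 < signForm w z → 0 < signForm w ((∑ i, x i)⁻¹ • x) := by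
      intro w hwv hw
      rw [map_smul, smul_eq_mul]
      exact mul_pos (inv_pos.2 hxs) (hx w hwv hw)
    obtain ⟨h1, h2⟩ := isFacet_signFace (p := c • z) (x := (∑ i, x i)⁻¹ • x) (v := v) hp1
      ((hform0 v).2 (by rw [hv]; exact one_pos))
      (by
        simp only [Pi.smul_apply, smul_eq_mul, ← Finset.mul_sum]
        exact inv_mul_cancel₀ hxs.ne')
      (by rw [map_smul, hvx, smul_zero]) (fun w hwv hw => hx' w hwv ((hform0 w).1 hw))
    exact ⟨_, h1, h2, hx'⟩
  have hregion : IsRegion n (signCell (c • z)) :=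
    ⟨c • z, hmem, (connectedComponentIn_arrangementComplement hmem).symm⟩
  refine le_trans ?_ (facetCount_le_maxFacetsPos hregion fun x hx i => ?_)
  · rw [facetCount, closure_signCell hp1]
    refine Set.ncard_le_ncard_of_injOn (signFace (c • z)) (fun v hv => ?_) (fun v hv w hw h => ?_) ?_
    · obtain ⟨x, -, h, -⟩ := hfacet v hv
      exact h
    · obtain ⟨x, hx, -, hx'⟩ := hfacet v hv
      by_contra hne
      have h0 := hx' w (Ne.symm hne) (by rw [show signForm w z = 1 from hw]; exact one_pos)
      rw [h] at hx
      exact h0.ne' hx.2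
    · refine (Set.finite_range (signFace (c • z))).subset fun F hF => ?_
      obtain ⟨v, -, rfl⟩ := exists_isIndecomposable_of_isFacet hp1 hF
      exact ⟨v, rfl⟩
  · have := hx.2 (diffSign {i} ∅) (by
      rw [hform0, signForm_diffSign]
      simpa using hpos i)
    rw [signForm_diffSign] at this
    simpa using this

/-! ### Signed binary representations -/

/-- The integer with the given signed binary digits, the least significant one first. -/
def signedBinary (v : Fin n → SignType) : ℤ := ∑ i, (v i : ℤ) * 2 ^ (i : ℕ)

lemma signedBinary_cons (a : SignType) (v : Fin n → SignType) :
    signedBinary (Fin.cons a v : Fin (n + 1) → SignType) = a + 2 * signedBinary v := by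
  simp only [signedBinary, Fin.sum_univ_succ, Fin.cons_zero, Fin.cons_succ, Fin.val_zero, pow_zero,
    mul_one, Fin.val_succ, pow_succ, Finset.mul_sum]
  congr 1
  exact Finset.sum_congr rfl fun i _ => by ring

lemma eq_zero_of_coe_add_two_mul_eq_zero {a : SignType} {k : ℤ} (h : (a : ℤ) + 2 * k = 0) :
    a = 0 := by
  rcases a.trichotomy with rfl | rfl | rfl
  · simp at h; omega
  · rfl
  · simp at h; omega

lemma eq_zero_of_signedBinary_eq_zero {v : Fin n → SignType} (h : signedBinary v = 0) : v = 0 := by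
  induction n with
  | zero => exact Subsingleton.elim _ _
  | succ n ih =>
    induction v using Fin.consCases with
    | _ a v =>
      rw [signedBinary_cons] at h
      obtain rfl := eq_zero_of_coe_add_two_mul_eq_zero h
      have hv : v = 0 := ih (by simpa using h)
      subst hv
      ext i
      refine Fin.cases ?_ (fun j => ?_) i <;> simp

/-- The set of signed binary representations of an integer by `n` digits. -/
def signedBinaryReps (n : ℕ) (k : ℤ) : Finset (Fin n → SignType) :=
  Finset.univ.filter fun v => signedBinary v = k

lemma mem_signedBinaryReps {k : ℤ} {v : Fin n → SignType} :
    v ∈ signedBinaryReps n k ↔ signedBinary v = k := by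
  simp [signedBinaryReps]

lemma card_signedBinaryReps_le_two_mul (n : ℕ) (k : ℤ) :
    (signedBinaryReps n k).card ≤ (signedBinaryReps (n + 1) (2 * k)).card := by
  refine Finset.card_le_card_of_injOn (fun v => Fin.cons 0 v) (fun v hv => ?_)
    fun v _ w _ h => (Fin.cons_injective2 h).2
  have hv' := mem_signedBinaryReps.1 hv
  rw [Finset.mem_coe, mem_signedBinaryReps, signedBinary_cons, hv']
  simp

/-- Since `k + l = -a + 2 * k = a + 2 * l`, prepending `-a` to representations of `k` and `a` to
those of `l` gives two disjoint families. -/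
lemma card_signedBinaryReps_add_le (n : ℕ) (k l : ℤ) (a : SignType) (ha : a ≠ 0)
    (h : k - l = (a : ℤ)) :
    (signedBinaryReps n k).card + (signedBinaryReps n l).card ≤
      (signedBinaryReps (n + 1) (k + l)).card := by
  classical
  have hinj : ∀ b : SignType, Function.Injective
      (fun v : Fin n → SignType => (Fin.cons b v : Fin (n + 1) → SignType)) :=
    fun b v w h => (Fin.cons_injective2 h).2
  rw [← Finset.card_image_of_injective _ (hinj (-a)), ← Finset.card_image_of_injective _ (hinj a),
    ← Finset.card_union_of_disjoint]
  · refine Finset.card_le_card fun u hu => ?_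
    rw [Finset.mem_union, Finset.mem_image, Finset.mem_image] at hu
    rw [mem_signedBinaryReps]
    rcases hu with ⟨v, hv, rfl⟩ | ⟨v, hv, rfl⟩ <;> rw [mem_signedBinaryReps] at hv <;>
      rw [signedBinary_cons, hv]
    · rw [SignType.coe_neg]
      linarith
    · linarith
  · rw [Finset.disjoint_left]
    intro u hu hu'
    obtain ⟨v, -, rfl⟩ := Finset.mem_image.1 hu
    obtain ⟨w, -, hw⟩ := Finset.mem_image.1 hu'
    exact ha (SignType.self_eq_neg_iff.1 (Fin.cons_injective2 hw).1)

/-- Some odd positive integer has at least `F_{n+1}` signed binary representations by `n`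
digits. -/
lemma exists_odd_fib_le_card (n : ℕ) : ∃ k l : ℤ, ∃ a : SignType, a ≠ 0 ∧ k - l = (a : ℤ) ∧
    Odd k ∧ 0 < k ∧ 0 ≤ l ∧ Nat.fib (n + 2) ≤ (signedBinaryReps (n + 1) k).card ∧
    Nat.fib (n + 1) ≤ (signedBinaryReps (n + 1) l).card := by
  induction n with
  | zero =>
    refine ⟨1, 0, 1, by decide, by simp, odd_one, one_pos, le_rfl, ?_, ?_⟩
    · exact Finset.card_pos.2 ⟨fun _ => 1, mem_signedBinaryReps.2 (by simp [signedBinary])⟩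
    · exact Finset.card_pos.2 ⟨fun _ => 0, mem_signedBinaryReps.2 (by simp [signedBinary])⟩
  | succ n ih =>
    obtain ⟨k, l, a, ha, hkl, hodd, hk, hl, h1, h2⟩ := ih
    -- The step `(k, l) ↦ (k + l, 2 * k)` keeps the difference `±1` and reproduces the Fibonacci
    -- recursion in the two counts.
    refine ⟨k + l, 2 * k, -a, ?_, ?_, ?_, by linarith, by linarith, ?_, ?_⟩
    · rwa [Ne, SignType.neg_eq_zero_iff]
    · rw [SignType.coe_neg]
      linarith
    · rcases a.trichotomy with rfl | rfl | rfl
      · exact ⟨k, by simp at hkl; linarith⟩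
      · exact absurd rfl ha
      · exact ⟨l, by simp at hkl; linarith⟩
    · have := card_signedBinaryReps_add_le (n + 1) k l a ha hkl
      rw [show n + 1 + 2 = (n + 1) + 2 from rfl, Nat.fib_add_two]
      rw [show n + 1 + 1 = n + 2 from rfl] at *
      omega
    · exact h1.trans (card_signedBinaryReps_le_two_mul (n + 1) k)

/-- The weights `k, 2, 4, …, 2ⁿ`. -/
def binaryWeights (n : ℕ) (k : ℤ) : Fin (n + 1) → ℝ :=
  Fin.cons (k : ℝ) fun i => 2 ^ ((i : ℕ) + 1)

lemma signForm_cons_binaryWeights (k : ℤ) (a : SignType) (v : Fin n → SignType) :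
    signForm (Fin.cons a v : Fin (n + 1) → SignType) (binaryWeights n k) =
      ((a * k + 2 * signedBinary v : ℤ) : ℝ) := by
  rw [signForm_apply, Fin.sum_univ_succ]
  simp only [binaryWeights, Fin.cons_zero, Fin.cons_succ, signedBinary]
  push_cast
  rw [Finset.mul_sum]
  simp only [pow_succ]
  congr 1
  exact Finset.sum_congr rfl fun i _ => by ring

/-- Oddness of `k` forces the first sign to vanish, and 0 has only the trivial signed binary
representation. -/
lemma isGeneric_binaryWeights {k : ℤ} (hk : Odd k) : IsGeneric (binaryWeights n k) := by
  intro w hw h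
  induction w using Fin.consCases with
  | _ a v =>
    rw [signForm_cons_binaryWeights, Int.cast_eq_zero] at h
    obtain ⟨j, rfl⟩ := hk
    obtain rfl : a = 0 :=
      eq_zero_of_coe_add_two_mul_eq_zero (k := a * j + signedBinary v) (by linarith)
    have hv : v = 0 := eq_zero_of_signedBinary_eq_zero (by simpa using h)
    subst hv
    refine hw (funext fun i => ?_)
    refine Fin.cases ?_ (fun j => ?_) i <;> simp

/-- As `k` is odd, its lowest digit is `±1`; multiplying `k = v 0 + 2 * s` by `v 0` gives `v 0 * k -
2 * v 0 * s = 1`. -/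
lemma card_signedBinaryReps_le_ncard {k : ℤ} (hk : Odd k) :
    (signedBinaryReps (n + 1) k).card ≤
      {v : Fin (n + 1) → SignType | signForm v (binaryWeights n k) = 1}.ncard := by
  have hrep : ∀ v : Fin (n + 1) → SignType, signedBinary v = k →
      (v 0 = 1 ∨ v 0 = -1) ∧ (v 0 : ℤ) + 2 * signedBinary (Fin.tail v) = k := by
    intro v hv
    rw [← Fin.cons_self_tail v, signedBinary_cons] at hv
    refine ⟨?_, hv⟩
    rcases (v 0).trichotomy with h | h | h
    · exact Or.inr h
    · exfalso
      obtain ⟨j, rfl⟩ := hk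
      rw [h] at hv
      simp at hv
      omega
    · exact Or.inl h
  rw [← Set.ncard_coe_finset]
  refine Set.ncard_le_ncard_of_injOn
    (fun v => (Fin.cons (v 0) fun i => -v 0 * Fin.tail v i : Fin (n + 1) → SignType))
    (fun v hv => ?_) (fun v hv w hw h => ?_) (Set.toFinite _)
  · obtain ⟨h0, hv'⟩ := hrep v (mem_signedBinaryReps.1 hv)
    rw [Set.mem_ofPred_eq, signForm_cons_binaryWeights, ← hv']
    rw [Int.cast_eq_one]
    rcases h0 with h | h <;> rw [h] <;> simp [signedBinary]
  · obtain ⟨h1, h2⟩ := Fin.cons_injective2 h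
    have h0 := (hrep v (mem_signedBinaryReps.1 hv)).1
    rw [← Fin.cons_self_tail v, ← Fin.cons_self_tail w, h1]
    congr 1
    ext i
    have h3 := congrFun h2 i
    rw [← h1] at h3
    refine mul_left_cancel₀ ?_ h3
    rcases h0 with h | h <;> rw [h] <;> decide

lemma fib_le_maxFacetsPos {n : ℕ} (hn : 2 ≤ n) : Nat.fib (n + 1) ≤ maxFacetsPos n := by
  obtain ⟨m, rfl⟩ : ∃ m, n = m + 1 := ⟨n - 1, by omega⟩
  obtain ⟨k, -, -, -, -, hodd, hk, -, hcard, -⟩ := exists_odd_fib_le_card m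
  refine hcard.trans ((card_signedBinaryReps_le_ncard hodd).trans
    (ncard_le_maxFacetsPos hn (isGeneric_binaryWeights hodd) (fun i => ?_) fun w hw => ?_))
  · refine Fin.cases ?_ (fun j => ?_) i
    · simpa [binaryWeights] using hk
    · simp [binaryWeights]
  · induction w using Fin.consCases with
    | _ a v =>
      rw [signForm_cons_binaryWeights] at hw ⊢
      exact_mod_cast Int.cast_pos.1 hw

end ManyFacets

theorem mainTheorem4 :
    (∃ lam : ℝ, (0 < lam ∧ lam < 1 / 2 ∧ lam + entropyTwo lam = 1) ∧
      (∀ x : ℝ, 0 < x → x < 1 / 2 → x + entropyTwo x = 1 → x = lam) ∧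
      1.7087 < (2 : ℝ) ^ entropyTwo lam ∧ (2 : ℝ) ^ entropyTwo lam < 1.70875 ∧
      ∃ a b : ℝ, 0 < a ∧ 0 < b ∧ ∀ᶠ n : ℕ in atTop,
        a * (1.6180 : ℝ) ^ n < (maxFacetsPos n : ℝ) ∧
        maxFacetsPos n ≤ maxFacets n ∧
        maxFacets n ≤ maxFlippable n ∧
        (maxFlippable n : ℝ) < b * ((2 : ℝ) ^ entropyTwo lam) ^ n) ∧
    (∀ n : ℕ, 102 ≤ n →
      (Nat.fib (n + 1) : ℤ) = round (Real.goldenRatio ^ (n + 1) / √5) ∧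
      Nat.fib (n + 1) ≤ maxFlippable n ∧
      (maxFlippable n : ℝ) ≤ (1.7548 : ℝ) ^ n) := by
  obtain ⟨lam, hl1, hl2, hlam⟩ := exists_add_entropyTwo_eq_one
  have h0 : 0 < lam := by linarith
  have h1 : lam < 1 / 2 := by linarith
  have hH : entropyTwo lam = 1 - lam := by linarith
  have hup := two_rpow_one_sub_lt hl1
  have hlow := lt_two_rpow_one_sub hl2
  rw [← hH] at hup hlow
  -- Taking 3 rather than 2 as the upper constant makes the inequality strict.
  refine ⟨⟨lam, ⟨h0, h1, hlam⟩, fun x hx0 hx1 hx => eq_of_add_entropyTwo_eq_one hx0 hx1 h0 h1 hx hlam,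
    hlow, hup, 1 / 3, 3, by norm_num, by norm_num, ?_⟩, fun n hn => ⟨fib_eq_round n, ?_, ?_⟩⟩
  · filter_upwards [eventually_ge_atTop 2] with n hn
    refine ⟨(pow_lt_mul_fib n).trans_le (Nat.cast_le.2 (fib_le_maxFacetsPos hn)),
      maxFacetsPos_le_maxFacets n, maxFacets_le_maxFlippable n,
      (maxFlippable_le h0 h1 hlam n).trans_lt ?_⟩
    have : (0 : ℝ) < ((2 : ℝ) ^ entropyTwo lam) ^ n := by positivity
    linarith
  · exact (fib_le_maxFacetsPos (by omega)).trans
      ((maxFacetsPos_le_maxFacets n).trans (maxFacets_le_maxFlippable n))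
  · exact (maxFlippable_le h0 h1 hlam n).trans (two_mul_pow_le (by positivity) hup hn)
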